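/- Let $n,m\ge 1$ be integers and let $q(z,w)=\sum_{j=0}^{n}\sum_{k=0}^{m}a_{j,k}z^jw^k$ be a polynomial in two complex variables of degree at most $(n,m)$, with $a_{j,k}\in\mathbb{C}$. Define its reflection (at the level $(n,m)$) by \[ \tilde q(z,w)=\sum_{j=0}^{n}\sum_{k=0}^{m}\overline{a_{n-j,\,m-k}}\,z^jw^k , \] so that $\tilde q(z,w)=z^nw^m\,\overline{q(1/\bar z,1/\bar w)}$ for $z,w\neq 0$. Then $q$ has no zeros in the closed bidisk $\overline{\mathbb{D}}^2=\{(z,w)\in\mathbb{C}^2:|z|\le 1,\ |w|\le 1\}$ if and only if there exists a constant $c>0$ such that \[ |q(z,w)|^2-|\tilde q(z,w)|^2\ \ge\ c\,(1-|z|^2)(1-|w|^2)\qquad\text{for all }(z,w)\in\overline{\mathbb{D}}^2 . \] Moreover, if $q$ has no zeros in $\overline{\mathbb{D}}^2$, then this inequality holds on $\overline{\mathbb{D}}^2$ with the constant $c>0$ given by \[ \frac1c=\frac{1}{(2\pi i)^2}\int_{\mathbb{T}^2}\frac{1}{|q(z,w)|^2}\,\frac{dz}{z}\,\frac{dw}{w},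 \] where $\mathbb{T}^2=\{(z,w):|z|=|w|=1\}$. -/

import Mathlib

open MvPolynomial

/-- The polynomial `q` in the variables `z = X 0`, `w = X 1` has no zeros in the closed bidisk. -/
def IsStable (q : MvPolynomial (Fin 2) ℂ) : Prop :=
  ∀ z w : ℂ, ‖z‖ ≤ 1 → ‖w‖ ≤ 1 → eval ![z, w] q ≠ 0

/-- The reflection of `q` at the level `(n, m)`:
the polynomial `∑ j ≤ n, ∑ k ≤ m, conj (a (n - j) (m - k)) z ^ j w ^ k`,
where `a j k` is the coefficient of `z ^ j w ^ k` in `q`. -/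
noncomputable def reflection (n m : ℕ) (q : MvPolynomial (Fin 2) ℂ) : MvPolynomial (Fin 2) ℂ :=
  ∑ j ∈ Finset.range (n + 1), ∑ k ∈ Finset.range (m + 1),
    C (starRingEnd ℂ (coeff (Finsupp.single 0 (n - j) + Finsupp.single 1 (m - k)) q)) *
      X 0 ^ j * X 1 ^ k

/-- The inequality `|q|² - |q̃|² ≥ c (1 - |z|²) (1 - |w|²)` on the closed bidisk, where `q̃` is the
reflection of `q` at the level `(n, m)`. -/
def BidiskBound (n m : ℕ) (q : MvPolynomial (Fin 2) ℂ) (c : ℝ) : Prop :=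
  ∀ z w : ℂ, ‖z‖ ≤ 1 → ‖w‖ ≤ 1 →
    c * (1 - ‖z‖ ^ 2) * (1 - ‖w‖ ^ 2) ≤
      ‖eval ![z, w] q‖ ^ 2 - ‖eval ![z, w] (reflection n m q)‖ ^ 2

/-- The integral `(2πi)⁻² ∫ |q(z, w)|⁻² dz/z dw/w` over the 2-torus `|z| = |w| = 1`. -/
noncomputable def torusMeanInv (q : MvPolynomial (Fin 2) ℂ) : ℂ :=
  1 / (2 * (Real.pi : ℂ) * Complex.I) ^ 2 *
    torusIntegral (fun x : Fin 2 → ℂ => 1 / (‖eval x q‖ : ℂ) ^ 2 * (1 / x 0) * (1 / x 1)) 0 1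

/-- A polynomial of degree at most `(n, m)` is `∑ j ≤ n, ∑ k ≤ m, a j k z ^ j w ^ k`. -/
theorem eval_eq_sum_of_degree_le (n m : ℕ) (q : MvPolynomial (Fin 2) ℂ)
    (hz : q.degreeOf 0 ≤ n) (hw : q.degreeOf 1 ≤ m) (z w : ℂ) :
    eval ![z, w] q = ∑ j ∈ Finset.range (n + 1), ∑ k ∈ Finset.range (m + 1),
      coeff (Finsupp.single 0 j + Finsupp.single 1 k) q * z ^ j * w ^ k := by
  have hinj : Function.Injective
      (fun p : ℕ × ℕ => (Finsupp.single 0 p.1 + Finsupp.single 1 p.2 : Fin 2 →₀ ℕ)) := by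
    intro p p' h
    have h0 := DFunLike.congr_fun h 0
    have h1 := DFunLike.congr_fun h 1
    simp at h0 h1
    exact Prod.ext h0 h1
  rw [eval_eq', ← Finset.sum_product']
  have hsub : q.support ⊆ (Finset.range (n + 1) ×ˢ Finset.range (m + 1)).image
      (fun p : ℕ × ℕ => (Finsupp.single 0 p.1 + Finsupp.single 1 p.2 : Fin 2 →₀ ℕ)) := by
    intro d hd
    have h0 := (degreeOf_le_iff.mp hz) d hd
    have h1 := (degreeOf_le_iff.mp hw) d hd
    refine Finset.mem_image.mpr ⟨(d 0, d 1), ?_, ?_⟩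
    · simp only [Finset.mem_product, Finset.mem_range]
      omega
    · ext i
      fin_cases i <;> simp
  rw [Finset.sum_subset hsub, Finset.sum_image (fun _ _ _ _ h => hinj h)]
  · refine Finset.sum_congr rfl fun p _ => ?_
    simp [Fin.prod_univ_two, mul_assoc]
  · intro d _ hd
    rw [notMem_support_iff.mp hd, zero_mul]

/-- Away from the axes, the reflection is `z ^ n w ^ m conj (q (1 / conj z, 1 / conj w))`. -/
theorem eval_reflection (n m : ℕ) (q : MvPolynomial (Fin 2) ℂ)
    (hz : q.degreeOf 0 ≤ n) (hw : q.degreeOf 1 ≤ m) (z w : ℂ) (hz0 : z ≠ 0) (hw0 : w ≠ 0) :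
    eval ![z, w] (reflection n m q) = z ^ n * w ^ m *
      starRingEnd ℂ (eval ![1 / starRingEnd ℂ z, 1 / starRingEnd ℂ w] q) := by
  rw [eval_eq_sum_of_degree_le n m q hz hw, reflection]
  simp only [map_sum, map_mul, map_pow, eval_C, eval_X, Finset.mul_sum, map_div₀, map_one,
    Complex.conj_conj, Matrix.cons_val_zero, Matrix.cons_val_one]
  rw [← Finset.sum_range_reflect]
  refine Finset.sum_congr rfl fun j hj => ?_
  rw [← Finset.sum_range_reflect]
  refine Finset.sum_congr rfl fun k hk => ?_
  simp only [Finset.mem_range] at hj hk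
  have h1 : n - (n + 1 - 1 - j) = j := by omega
  have h2 : m - (m + 1 - 1 - k) = k := by omega
  have h3 : z ^ n = z ^ (n + 1 - 1 - j) * z ^ j := by rw [← pow_add]; congr 1; omega
  have h4 : w ^ m = w ^ (m + 1 - 1 - k) * w ^ k := by rw [← pow_add]; congr 1; omega
  rw [h1, h2, h3, h4]
  simp only [one_div, inv_pow]
  field_simp

/-! For stable `q`, fix (a, b) in the open bidisk, put B = q(a, b), D = q̃(a, b), and let K be the
Szegő kernel at (a, b). The function |K (q B̄ - q̃ D̄) - c|² / |q|² is nonnegative on the torus,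
where q̃ = zⁿwᵐ q̄. Up to conjugating cross terms, its expansion is a holomorphic function times K̄,
plus a holomorphic function vanishing at the origin, plus c²/|q|². Cauchy's formula
(`torusMean_cauchy`) gives the mean K(a, b)(|B|² - |D|²) - 2c + c²·(1/c), whose nonnegativity is the
bound (`bidiskBound_interior`); continuity carries it to the boundary.

Conversely, a zero of `q` contradicts the bound. Inside the bidisk this is immediate. If exactly one
coordinate is unimodular, |q|² vanishes to second order along a radius while the lower bound is of
first order. At a torus point |q|² and |q̃|² have the same second-order term along the radius, so
their difference is o((1 - r)²), against a lower bound of order (1 - r)². -/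

/-! ### Means over the torus and Cauchy's formula -/

open MeasureTheory in
/-- The mean of `f` over the torus `|x 0| = |x 1| = 1`. -/
noncomputable def torusMean (f : (Fin 2 → ℂ) → ℂ) : ℂ :=
  ((2 * (Real.pi : ℂ)) ^ 2)⁻¹ *
    ∫ θ : Fin 2 → ℝ in Set.Icc 0 fun _ => 2 * Real.pi, f (torusMap 0 1 θ)

theorem norm_torusMap_zero_one (θ : Fin 2 → ℝ) (i : Fin 2) : ‖torusMap 0 1 θ i‖ = 1 := by
  simp [torusMap, Complex.norm_exp_ofReal_mul_I]

theorem continuous_torusMap (c : Fin 2 → ℂ) (R : Fin 2 → ℝ) : Continuous (torusMap c R) := by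
  unfold torusMap
  fun_prop

theorem continuous_comp_torusMap {f : (Fin 2 → ℂ) → ℂ}
    (hf : ∀ x, (∀ i, ‖x i‖ = 1) → ContinuousAt f x) :
    Continuous fun θ : Fin 2 → ℝ => f (torusMap 0 1 θ) :=
  continuous_iff_continuousAt.2 fun θ =>
    (hf _ (norm_torusMap_zero_one θ)).comp (continuous_torusMap 0 1).continuousAt

theorem torusIntegrable_of_continuousAt {f : (Fin 2 → ℂ) → ℂ}
    (hf : ∀ x, (∀ i, ‖x i‖ = 1) → ContinuousAt f x) : TorusIntegrable f 0 1 :=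
  (continuous_comp_torusMap hf).continuousOn.integrableOn_compact isCompact_Icc

theorem torusMean_add {f g : (Fin 2 → ℂ) → ℂ} (hf : TorusIntegrable f 0 1)
    (hg : TorusIntegrable g 0 1) :
    torusMean (fun x => f x + g x) = torusMean f + torusMean g := by
  rw [torusMean, MeasureTheory.integral_add hf hg, mul_add]
  rfl

theorem torusMean_const_mul (a : ℂ) (f : (Fin 2 → ℂ) → ℂ) :
    torusMean (fun x => a * f x) = a * torusMean f := by
  rw [torusMean, MeasureTheory.integral_const_mul, mul_left_comm]
  rfl

theorem torusMean_ofReal (f : (Fin 2 → ℂ) → ℝ) :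
    torusMean (fun x => (f x : ℂ)) = ((((2 * Real.pi) ^ 2)⁻¹ *
      ∫ θ : Fin 2 → ℝ in Set.Icc 0 fun _ => 2 * Real.pi, f (torusMap 0 1 θ) : ℝ) : ℂ) := by
  rw [torusMean, integral_complex_ofReal]
  push_cast
  rfl

theorem re_torusMean_nonneg {f : (Fin 2 → ℂ) → ℂ} (hf : TorusIntegrable f 0 1)
    (h : ∀ x, (∀ i, ‖x i‖ = 1) → 0 ≤ (f x).re) : 0 ≤ (torusMean f).re := by
  have h1 : ((2 * (Real.pi : ℂ)) ^ 2)⁻¹ = ((((2 * Real.pi) ^ 2)⁻¹ : ℝ) : ℂ) := by push_cast; rfl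
  rw [torusMean, h1, Complex.re_ofReal_mul]
  refine mul_nonneg (by positivity) ?_
  have h2 := integral_re (𝕜 := ℂ) hf
  simp only [RCLike.re_to_complex] at h2
  rw [← h2]
  exact MeasureTheory.integral_nonneg fun θ => h _ (norm_torusMap_zero_one θ)

/-- Each dz/z = i dθ contributes a factor i; the resulting i² cancels the one in (2πi)². -/
theorem torusMean_eq_torusIntegral (f : (Fin 2 → ℂ) → ℂ) :
    torusMean f = 1 / (2 * (Real.pi : ℂ) * Complex.I) ^ 2 *
      torusIntegral (fun x => f x * (1 / x 0) * (1 / x 1)) 0 1 := by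
  have h : ∀ θ : Fin 2 → ℝ,
      (∏ i, ((1 : Fin 2 → ℝ) i : ℂ) * Complex.exp (θ i * Complex.I) * Complex.I) •
        (f (torusMap 0 1 θ) * (1 / torusMap 0 1 θ 0) * (1 / torusMap 0 1 θ 1)) =
      -1 * f (torusMap 0 1 θ) := by
    intro θ
    have h0 : torusMap 0 1 θ 0 = Complex.exp (θ 0 * Complex.I) := by simp [torusMap]
    have h1 : torusMap 0 1 θ 1 = Complex.exp (θ 1 * Complex.I) := by simp [torusMap]
    rw [h0, h1, Fin.prod_univ_two, smul_eq_mul, ← Complex.I_mul_I]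
    have e0 := Complex.exp_ne_zero (θ 0 * Complex.I)
    have e1 := Complex.exp_ne_zero (θ 1 * Complex.I)
    simp only [Pi.one_apply, Complex.ofReal_one]
    field_simp
  rw [torusIntegral]
  simp only [h]
  rw [MeasureTheory.integral_const_mul, torusMean,
    mul_pow (2 * (Real.pi : ℂ)) Complex.I, Complex.I_sq]
  ring

theorem torusMeanInv_eq_torusMean (q : MvPolynomial (Fin 2) ℂ) :
    torusMeanInv q = torusMean fun x => ((1 / ‖eval x q‖ ^ 2 : ℝ) : ℂ) := by
  rw [torusMean_eq_torusIntegral, torusMeanInv]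
  push_cast
  rfl

/-- The Cauchy integral formula on the bidisk. -/
theorem torusMean_cauchy {F : (Fin 2 → ℂ) → ℂ}
    (hF : ∀ x, (∀ i, ‖x i‖ ≤ 1) → DifferentiableAt ℂ F x) {a b : ℂ} (ha : ‖a‖ < 1) (hb : ‖b‖ < 1) :
    torusMean (fun x => F x * (x 0 / (x 0 - a)) * (x 1 / (x 1 - b))) = F ![a, b] := by
  have hne : ∀ {u v : ℂ}, ‖u‖ = 1 → ‖v‖ < 1 → u - v ≠ 0 := by
    intro u v hu hv h
    rw [sub_eq_zero.1 h] at hu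
    exact absurd hu hv.ne
  have hT : TorusIntegrable (fun x => (x 0 - a)⁻¹ * ((x 1 - b)⁻¹ * F x)) 0 1 := by
    refine torusIntegrable_of_continuousAt fun x hx => ?_
    have h0 := hne (hx 0) ha
    have h1 := hne (hx 1) hb
    have h2 : ContinuousAt F x := (hF x fun i => (hx i).le).continuousAt
    exact ContinuousAt.mul (((continuous_apply 0).sub continuous_const).continuousAt.inv₀ h0)
      (ContinuousAt.mul (((continuous_apply 1).sub continuous_const).continuousAt.inv₀ h1) h2)
  have hcongr : torusIntegral
      (fun x => F x * (x 0 / (x 0 - a)) * (x 1 / (x 1 - b)) * (1 / x 0) * (1 / x 1)) 0 1 =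
      torusIntegral (fun x => (x 0 - a)⁻¹ * ((x 1 - b)⁻¹ * F x)) 0 1 := by
    unfold torusIntegral
    congr 1
    ext θ
    congr 1
    have hx := norm_torusMap_zero_one θ
    have h0 := hne (hx 0) ha
    have h1 := hne (hx 1) hb
    have h2 : torusMap 0 1 θ 0 ≠ 0 := norm_ne_zero_iff.1 (by rw [hx]; exact one_ne_zero)
    have h3 : torusMap 0 1 θ 1 ≠ 0 := norm_ne_zero_iff.1 (by rw [hx]; exact one_ne_zero)
    field_simp
  have hinner : ∀ z : ℂ, ‖z‖ ≤ 1 →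
      (∮ w in C(0, 1), (w - b)⁻¹ • F ![z, w]) = (2 * Real.pi * Complex.I : ℂ) • F ![z, b] := by
    intro z hz
    refine DifferentiableOn.circleIntegral_sub_inv_smul (fun w hw => ?_) (by simpa using hb)
    refine DifferentiableAt.differentiableWithinAt ?_
    refine DifferentiableAt.comp w (f := fun w => ![z, w]) (hF _ fun i => ?_) ?_
    · fin_cases i
      · simpa using hz
      · simpa using hw
    · refine differentiableAt_pi.2 fun i => ?_
      fin_cases i <;> simp
  have houter :
      (∮ z in C(0, 1), (z - a)⁻¹ • F ![z, b]) = (2 * Real.pi * Complex.I : ℂ) • F ![a, b] := by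
    refine DifferentiableOn.circleIntegral_sub_inv_smul (f := fun z => F ![z, b])
      (fun z hz => ?_) (by simpa using ha)
    refine DifferentiableAt.differentiableWithinAt ?_
    refine DifferentiableAt.comp z (f := fun z => ![z, b]) (hF _ fun i => ?_) ?_
    · fin_cases i
      · simpa using hz
      · simpa using hb.le
    · refine differentiableAt_pi.2 fun i => ?_
      fin_cases i <;> simp
  rw [torusMean_eq_torusIntegral, hcongr, torusIntegral_succ hT]
  simp only [torusIntegral_dim1]
  have hstep : ∀ z ∈ Metric.sphere (0 : ℂ) 1,
      (∮ w in C(0, 1), (z - a)⁻¹ * ((w - b)⁻¹ * F ![z, w])) =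
        (2 * Real.pi * Complex.I : ℂ) * ((z - a)⁻¹ • F ![z, b]) := by
    intro z hz
    have := hinner z (by simpa using hz.le)
    simp only [smul_eq_mul] at this ⊢
    rw [circleIntegral.integral_const_mul, this]
    ring
  have hrw : (∮ z in C(0, 1), ∮ w in C(0, 1), (z - a)⁻¹ * ((w - b)⁻¹ * F ![z, w])) =
      (2 * Real.pi * Complex.I : ℂ) ^ 2 * F ![a, b] := by
    rw [circleIntegral.integral_congr zero_le_one hstep, circleIntegral.integral_const_mul,
      houter, smul_eq_mul]
    ring
  have hpi : (2 * Real.pi * Complex.I : ℂ) ^ 2 ≠ 0 := pow_ne_zero 2 Complex.two_pi_I_ne_zero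
  have hcons : ∀ z w : ℂ, (Fin.cons z fun _ => w : Fin 2 → ℂ) = ![z, w] := by
    intro z w
    ext i
    fin_cases i <;> rfl
  simp only [hcons, Pi.zero_apply, Pi.one_apply, Function.comp_apply, Matrix.cons_val_zero,
    Matrix.cons_val_one]
  rw [hrw]
  field_simp

/-! ### Stability implies the bound -/

-- Only real parts matter, so each cross term may be replaced by its conjugate. The choice made here
-- leaves 1/Q but no 1/Q̄ in every cross term, ready for Cauchy's formula with Q = q(x) and P =
-- zⁿwᵐ.
open ComplexConjugate in
theorem re_kernel_expansion {K Q P B D : ℂ} (c : ℝ) (hQ : Q ≠ 0) (hP : P * conj P = 1) :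
    (K * conj K * (B * conj B + D * conj D) -
        2 * (K * conj K) * (B * conj D * (P * conj Q / Q)) -
        2 * c * (conj K * B / Q) + 2 * c * (conj D * K * P / Q) + c ^ 2 / (Q * conj Q)).re =
      ‖K * (Q * conj B - P * conj Q * conj D) - c‖ ^ 2 / ‖Q‖ ^ 2 := by
  have hQ' : conj Q ≠ 0 := (map_ne_zero _).2 hQ
  have hP0 : P ≠ 0 := left_ne_zero_of_mul_eq_one hP
  have hP' : conj P = P⁻¹ := eq_inv_of_mul_eq_one_right hP
  have h : ∀ u : ℂ, ((‖u‖ ^ 2 : ℝ) : ℂ) = u * conj u := by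
    intro u
    rw [Complex.mul_conj, Complex.normSq_eq_norm_sq]
  rw [← Complex.ofReal_inj, Complex.re_eq_add_conj, Complex.ofReal_div, h, h]
  simp only [map_add, map_sub, map_mul, map_div₀, map_pow, Complex.conj_conj,
    Complex.conj_ofReal, map_ofNat, hP']
  field_simp
  ring

theorem differentiableAt_eval (q : MvPolynomial (Fin 2) ℂ) (x : Fin 2 → ℂ) :
    DifferentiableAt ℂ (fun y => eval y q) x := by
  induction q using MvPolynomial.induction_on with
  | C a => simp
  | add p q hp hq =>
    simp only [map_add]
    exact hp.add hq
  | mul_X p i hp =>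
    simp only [map_mul, eval_X]
    exact hp.mul (differentiableAt_apply i x)

theorem eval_ne_zero_of_isStable {q : MvPolynomial (Fin 2) ℂ} (hq : IsStable q) {x : Fin 2 → ℂ}
    (hx : ∀ i, ‖x i‖ ≤ 1) : eval x q ≠ 0 := by
  have h : x = ![x 0, x 1] := by
    ext i
    fin_cases i <;> rfl
  rw [h]
  exact hq _ _ (hx 0) (hx 1)

open ComplexConjugate in
theorem eval_reflection_of_norm_eq_one (n m : ℕ) (q : MvPolynomial (Fin 2) ℂ)
    (hz : q.degreeOf 0 ≤ n) (hw : q.degreeOf 1 ≤ m) {x : Fin 2 → ℂ} (hx : ∀ i, ‖x i‖ = 1) :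
    eval x (reflection n m q) = x 0 ^ n * x 1 ^ m * conj (eval x q) := by
  have h : x = ![x 0, x 1] := by
    ext i
    fin_cases i <;> rfl
  have h1 : ∀ i, 1 / conj (x i) = x i := by
    intro i
    rw [one_div, Complex.inv_def, Complex.normSq_eq_norm_sq, Complex.norm_conj, hx]
    simp
  have hx0 : ∀ i, x i ≠ 0 := fun i => norm_ne_zero_iff.1 (by rw [hx]; exact one_ne_zero)
  have := eval_reflection n m q hz hw (x 0) (x 1) (hx0 0) (hx0 1)
  rwa [h1, h1, ← h] at this

/-- For stable `q`, the integral of `|q|⁻²` over the torus is a positive real number. -/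
theorem exists_pos_one_div_eq_torusMeanInv {q : MvPolynomial (Fin 2) ℂ} (hq : IsStable q) :
    ∃ c : ℝ, 0 < c ∧ 1 / (c : ℂ) = torusMeanInv q := by
  set f : (Fin 2 → ℝ) → ℝ := fun θ => 1 / ‖eval (torusMap 0 1 θ) q‖ ^ 2 with hf
  have hpos : ∀ θ, 0 < f θ := fun θ => by
    have := eval_ne_zero_of_isStable hq fun i => (norm_torusMap_zero_one θ i).le
    have := norm_pos_iff.2 this
    positivity
  have hcont : Continuous f := by
    refine continuous_const.div₀ (Continuous.pow (Continuous.norm ?_) 2) fun θ => ?_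
    · exact continuous_comp_torusMap fun x _ => (differentiableAt_eval q x).continuousAt
    · have := eval_ne_zero_of_isStable hq fun i => (norm_torusMap_zero_one θ i).le
      have := norm_pos_iff.2 this
      positivity
  have hint : 0 < ∫ θ : Fin 2 → ℝ in Set.Icc 0 fun _ => 2 * Real.pi, f θ := by
    rw [MeasureTheory.setIntegral_pos_iff_support_of_nonneg_ae
      (Filter.Eventually.of_forall fun θ => (hpos θ).le)
      (hcont.continuousOn.integrableOn_compact isCompact_Icc)]
    have hs : Function.support f = Set.univ := Set.eq_univ_of_forall fun θ => (hpos θ).ne'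
    rw [hs, Set.univ_inter, Real.volume_Icc_pi]
    simp only [Pi.zero_apply, sub_zero, Finset.prod_const]
    exact pos_iff_ne_zero.2 (pow_ne_zero _ (ENNReal.ofReal_pos.2 (by positivity)).ne')
  refine ⟨(((2 * Real.pi) ^ 2)⁻¹ * ∫ θ : Fin 2 → ℝ in Set.Icc 0 fun _ => 2 * Real.pi, f θ)⁻¹,
    by positivity, ?_⟩
  rw [torusMeanInv_eq_torusMean, torusMean_ofReal, Complex.ofReal_inv, one_div, inv_inv]

-- Since x̄ = 1/x on the circle, the conjugate Szegő kernel is the Cauchy kernel for the measure dθ.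
open ComplexConjugate in
theorem conj_szego_kernel {x a : ℂ} (hx : ‖x‖ = 1) (ha : ‖a‖ < 1) :
    conj (1 / (1 - x * conj a)) = x / (x - a) := by
  have hx0 : x ≠ 0 := norm_ne_zero_iff.1 (by rw [hx]; exact one_ne_zero)
  have h : conj x = x⁻¹ := by
    rw [Complex.inv_def, Complex.normSq_eq_norm_sq, hx]
    simp
  have h1 : x - a ≠ 0 := by
    intro h
    rw [sub_eq_zero.1 h] at hx
    exact hx.not_lt ha
  simp only [map_div₀, map_one, map_sub, map_mul, Complex.conj_conj, h]
  have h2 : 1 - x⁻¹ * a ≠ 0 := by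
    have : 1 - x⁻¹ * a = x⁻¹ * (x - a) := by field_simp
    rw [this]
    exact mul_ne_zero (inv_ne_zero hx0) h1
  field_simp

open ComplexConjugate in
theorem one_sub_mul_conj_ne_zero {x a : ℂ} (hx : ‖x‖ ≤ 1) (ha : ‖a‖ < 1) : 1 - x * conj a ≠ 0 := by
  intro h
  have h1 : ‖x * conj a‖ = 1 := by rw [← sub_eq_zero.1 h, norm_one]
  rw [norm_mul, Complex.norm_conj] at h1
  nlinarith [norm_nonneg a, norm_nonneg x]

open ComplexConjugate in
/-- The bound in the open bidisk. -/
theorem bidiskBound_interior {n m : ℕ} (hn : 0 < n) {q : MvPolynomial (Fin 2) ℂ}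
    (hz : q.degreeOf 0 ≤ n) (hw : q.degreeOf 1 ≤ m) (hq : IsStable q) {c : ℝ} (hc : 0 < c)
    (hcq : 1 / (c : ℂ) = torusMeanInv q) {a b : ℂ} (ha : ‖a‖ < 1) (hb : ‖b‖ < 1) :
    c * (1 - ‖a‖ ^ 2) * (1 - ‖b‖ ^ 2) ≤
      ‖eval ![a, b] q‖ ^ 2 - ‖eval ![a, b] (reflection n m q)‖ ^ 2 := by
  set B := eval ![a, b] q with hB
  set D := eval ![a, b] (reflection n m q) with hD
  have hB0 : B ≠ 0 := hq a b ha.le hb.le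
  set K : (Fin 2 → ℂ) → ℂ := fun x => 1 / (1 - x 0 * conj a) * (1 / (1 - x 1 * conj b)) with hK
  set E : (Fin 2 → ℂ) → ℂ := fun x => eval x q with hE
  set R : (Fin 2 → ℂ) → ℂ := fun x => eval x (reflection n m q) with hR
  -- `F` gathers the terms of the expansion divisible by K̄, with that factor removed.
  set F : (Fin 2 → ℂ) → ℂ := fun x => K x * (B * conj B + D * conj D) -
    2 * K x * (B * conj D * (R x / E x)) - 2 * c * (B / E x) with hF
  -- `H` is the cross term without K̄; its mean is its value at the origin.
  set H : (Fin 2 → ℂ) → ℂ := fun x =>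
    2 * c * (conj D * K x * (x 0 ^ n * x 1 ^ m) / E x) with hH
  set M : (Fin 2 → ℂ) → ℂ := fun x => ((1 / ‖eval x q‖ ^ 2 : ℝ) : ℂ) with hM
  have hKd : ∀ x, (∀ i, ‖x i‖ ≤ 1) → DifferentiableAt ℂ K x := by
    intro x hx
    have e0 := one_sub_mul_conj_ne_zero (hx 0) ha
    have e1 := one_sub_mul_conj_ne_zero (hx 1) hb
    fun_prop (disch := assumption)
  have hFd : ∀ x, (∀ i, ‖x i‖ ≤ 1) → DifferentiableAt ℂ F x := by
    intro x hx
    have e : E x ≠ 0 := eval_ne_zero_of_isStable hq hx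
    have d := hKd x hx
    have d1 : DifferentiableAt ℂ E x := differentiableAt_eval q x
    have d2 : DifferentiableAt ℂ R x := differentiableAt_eval (reflection n m q) x
    fun_prop (disch := assumption)
  have hHd : ∀ x, (∀ i, ‖x i‖ ≤ 1) → DifferentiableAt ℂ H x := by
    intro x hx
    have e : E x ≠ 0 := eval_ne_zero_of_isStable hq hx
    have d := hKd x hx
    have d1 : DifferentiableAt ℂ E x := differentiableAt_eval q x
    fun_prop (disch := assumption)
  have hMc : ∀ x, (∀ i, ‖x i‖ = 1) → ContinuousAt M x := by
    intro x hx
    have e := norm_pos_iff.2 (eval_ne_zero_of_isStable hq fun i => (hx i).le)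
    refine Complex.continuous_ofReal.continuousAt.comp ?_
    exact continuousAt_const.div₀ ((differentiableAt_eval q x).continuousAt.norm.pow 2)
      (by positivity)
  have hne : ∀ {u v : ℂ}, ‖u‖ = 1 → ‖v‖ < 1 → u - v ≠ 0 := by
    intro u v hu hv h
    rw [sub_eq_zero.1 h] at hu
    exact absurd hu hv.ne
  have hcauchyc : ∀ {E : (Fin 2 → ℂ) → ℂ} {u v : ℂ},
      (∀ x, (∀ i, ‖x i‖ ≤ 1) → DifferentiableAt ℂ E x) → ‖u‖ < 1 → ‖v‖ < 1 →
      ∀ x : Fin 2 → ℂ, (∀ i, ‖x i‖ = 1) →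
        ContinuousAt (fun x => E x * (x 0 / (x 0 - u)) * (x 1 / (x 1 - v))) x := by
    intro E u v hE hu hv x hx
    have c0 : ContinuousAt (fun x : Fin 2 → ℂ => x 0) x := (continuous_apply 0).continuousAt
    have c1 : ContinuousAt (fun x : Fin 2 → ℂ => x 1) x := (continuous_apply 1).continuousAt
    exact (((hE x fun i => (hx i).le).continuousAt).mul
      (c0.div₀ (c0.sub continuousAt_const) (hne (hx 0) hu))).mul
      (c1.div₀ (c1.sub continuousAt_const) (hne (hx 1) hv))
  have z1 : ‖(0 : ℂ)‖ < 1 := by simp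
  have cF := hcauchyc hFd ha hb
  -- Cauchy's formula at the origin is the mean value property, the kernel factors being 1.
  have cH := hcauchyc hHd z1 z1
  have cM : ∀ x, (∀ i, ‖x i‖ = 1) → ContinuousAt (fun x => (c : ℂ) ^ 2 * M x) x :=
    fun x hx => continuousAt_const.mul (hMc x hx)
  set G : (Fin 2 → ℂ) → ℂ := fun x =>
    F x * (x 0 / (x 0 - a)) * (x 1 / (x 1 - b)) +
      H x * (x 0 / (x 0 - 0)) * (x 1 / (x 1 - 0)) + (c : ℂ) ^ 2 * M x with hG
  have hmean : torusMean G = F ![a, b] + c := by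
    have hFH : TorusIntegrable (fun x => F x * (x 0 / (x 0 - a)) * (x 1 / (x 1 - b)) +
        H x * (x 0 / (x 0 - 0)) * (x 1 / (x 1 - 0))) 0 1 :=
      torusIntegrable_of_continuousAt fun x hx => (cF x hx).add (cH x hx)
    rw [hG, torusMean_add hFH (torusIntegrable_of_continuousAt cM), torusMean_add (torusIntegrable_of_continuousAt cF) (torusIntegrable_of_continuousAt cH),
      torusMean_cauchy hFd ha hb, torusMean_cauchy hHd z1 z1, torusMean_const_mul, hM,
      ← torusMeanInv_eq_torusMean, ← hcq]
    have hc' : (c : ℂ) ≠ 0 := Complex.ofReal_ne_zero.2 hc.ne'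
    -- The factor zⁿ with n > 0 kills this term.
    have : H ![0, 0] = 0 := by simp [hH, hn.ne']
    rw [this]
    field_simp
    ring
  have hGint : TorusIntegrable G 0 1 := torusIntegrable_of_continuousAt fun x hx =>
    ((cF x hx).add (cH x hx)).add (cM x hx)
  have hre : ∀ x, (∀ i, ‖x i‖ = 1) → 0 ≤ (G x).re := by
    intro x hx
    have e := eval_ne_zero_of_isStable hq fun i => (hx i).le
    have hx0 : ∀ i, x i ≠ 0 := fun i => norm_ne_zero_iff.1 (by rw [hx]; exact one_ne_zero)
    have hP : x 0 ^ n * x 1 ^ m * conj (x 0 ^ n * x 1 ^ m) = 1 := by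
      rw [Complex.mul_conj, Complex.normSq_eq_norm_sq]
      simp [hx]
    have hKc : conj (K x) = x 0 / (x 0 - a) * (x 1 / (x 1 - b)) := by
      rw [hK, map_mul, conj_szego_kernel (hx 0) ha, conj_szego_kernel (hx 1) hb]
    have hMx : M x = 1 / (eval x q * conj (eval x q)) := by
      rw [Complex.mul_conj, Complex.normSq_eq_norm_sq, hM]
      push_cast
      rfl
    have hGx : G x = K x * conj (K x) * (B * conj B + D * conj D) -
        2 * (K x * conj (K x)) *
          (B * conj D * (x 0 ^ n * x 1 ^ m * conj (eval x q) / eval x q)) -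
        2 * c * (conj (K x) * B / eval x q) +
        2 * c * (conj D * K x * (x 0 ^ n * x 1 ^ m) / eval x q) +
        c ^ 2 / (eval x q * conj (eval x q)) := by
      simp only [hG, hF, hH, hE, hR, hMx, sub_zero, div_self (hx0 _), hKc,
        eval_reflection_of_norm_eq_one n m q hz hw hx]
      ring
    rw [hGx, re_kernel_expansion c e hP]
    positivity
  have hfin := re_torusMean_nonneg hGint hre
  rw [hmean] at hfin
  have hsq : ∀ u : ℂ, u * conj u = ((‖u‖ ^ 2 : ℝ) : ℂ) := by
    intro u
    rw [Complex.mul_conj, Complex.normSq_eq_norm_sq]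
  have ha' : 0 < 1 - ‖a‖ ^ 2 := by nlinarith [norm_nonneg a]
  have hb' : 0 < 1 - ‖b‖ ^ 2 := by nlinarith [norm_nonneg b]
  have hFa : F ![a, b] + c =
      ((1 / ((1 - ‖a‖ ^ 2) * (1 - ‖b‖ ^ 2)) * (‖B‖ ^ 2 - ‖D‖ ^ 2) - c : ℝ) : ℂ) := by
    have hKa : K ![a, b] = ((1 / ((1 - ‖a‖ ^ 2) * (1 - ‖b‖ ^ 2)) : ℝ) : ℂ) := by
      simp only [hK, Matrix.cons_val_zero, Matrix.cons_val_one, hsq]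
      push_cast
      rw [one_div_mul_one_div]
    have hBD : B * conj D * (D / B) = ((‖D‖ ^ 2 : ℝ) : ℂ) := by
      rw [← hsq]
      field_simp
    simp only [hF, hE, hR, hKa, ← hB, ← hD, hBD, hsq, div_self hB0]
    push_cast
    ring
  rw [hFa, Complex.ofReal_re, sub_nonneg, one_div_mul_eq_div, le_div_iff₀ (by positivity)] at hfin
  linarith

theorem bidiskBound_of_isStable {n m : ℕ} (hn : 0 < n) {q : MvPolynomial (Fin 2) ℂ}
    (hz : q.degreeOf 0 ≤ n) (hw : q.degreeOf 1 ≤ m) (hq : IsStable q) {c : ℝ} (hc : 0 < c)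
    (hcq : 1 / (c : ℂ) = torusMeanInv q) : BidiskBound n m q c := by
  intro z w hz1 hw1
  have hlt : ∀ {r : ℝ} {u : ℂ}, r ∈ Set.Ioo (0 : ℝ) 1 → ‖u‖ ≤ 1 → ‖(r : ℂ) * u‖ < 1 := by
    intro r u hr hu
    rw [norm_mul, Complex.norm_real, Real.norm_of_nonneg hr.1.le]
    nlinarith [hr.1, hr.2, norm_nonneg u]
  have hev : ∀ p : MvPolynomial (Fin 2) ℂ,
      Continuous fun r : ℝ => eval ![(r : ℂ) * z, (r : ℂ) * w] p := by
    intro p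
    have h1 : Continuous fun x => eval x p :=
      continuous_iff_continuousAt.2 fun x => (differentiableAt_eval p x).continuousAt
    refine h1.comp (continuous_pi fun i => ?_)
    fin_cases i
    · exact Complex.continuous_ofReal.mul continuous_const
    · exact Complex.continuous_ofReal.mul continuous_const
  have hclosed : IsClosed {r : ℝ | c * (1 - ‖(r : ℂ) * z‖ ^ 2) * (1 - ‖(r : ℂ) * w‖ ^ 2) ≤
      ‖eval ![(r : ℂ) * z, (r : ℂ) * w] q‖ ^ 2 -
        ‖eval ![(r : ℂ) * z, (r : ℂ) * w] (reflection n m q)‖ ^ 2} :=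
    isClosed_le (by fun_prop) (((hev _).norm.pow 2).sub ((hev _).norm.pow 2))
  have hmem : (1 : ℝ) ∈ closure (Set.Ioo (0 : ℝ) 1) := by
    rw [closure_Ioo zero_ne_one]
    exact ⟨zero_le_one, le_rfl⟩
  have := hclosed.closure_subset_iff.2 (fun r hr =>
    bidiskBound_interior hn hz hw hq hc hcq (hlt hr hz1) (hlt hr hw1)) hmem
  simpa using this

/-! ### The bound implies stability -/

theorem differentiableAt_eval_line (p : MvPolynomial (Fin 2) ℂ) {u v : ℝ → ℂ} {r : ℝ}
    (hu : DifferentiableAt ℝ u r) (hv : DifferentiableAt ℝ v r) :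
    DifferentiableAt ℝ (fun r => eval ![u r, v r] p) r := by
  refine DifferentiableAt.comp r (f := fun r => ![u r, v r])
    ((differentiableAt_eval p _).restrictScalars ℝ) (differentiableAt_pi.2 fun i => ?_)
  fin_cases i
  · exact hu
  · exact hv

/-- A function differentiable at `1` and vanishing there does not satisfy `d (1 - r) ≤ |g r|²`. -/
theorem not_linear_le_norm_sq {g : ℝ → ℂ} (hg : DifferentiableAt ℝ g 1) (h1 : g 1 = 0) {d : ℝ}
    (hd : 0 < d) (h : ∀ r ∈ Set.Ioo (0 : ℝ) 1, d * (1 - r) ≤ ‖g r‖ ^ 2) : False := by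
  have hs : ContinuousAt (dslope g 1) 1 := continuousAt_dslope_same.2 hg
  have hlim : Filter.Tendsto (fun r : ℝ => (1 - r) * ‖dslope g 1 r‖ ^ 2)
      (nhdsWithin 1 (Set.Iio 1)) (nhds ((1 - 1) * ‖dslope g 1 1‖ ^ 2)) :=
    (((continuousAt_const.sub continuousAt_id).mul (hs.norm.pow 2)).tendsto).mono_left
      nhdsWithin_le_nhds
  rw [sub_self, zero_mul] at hlim
  refine absurd (ge_of_tendsto hlim (b := d) ?_) hd.not_ge
  filter_upwards [Ioo_mem_nhdsLT (zero_lt_one' ℝ)] with r hr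
  have hgr : g r = (r - 1) • dslope g 1 r := by rw [sub_smul_dslope, h1, sub_zero]
  have := h r hr
  rw [hgr, norm_smul, mul_pow, Real.norm_eq_abs, sq_abs] at this
  have h0 : 0 < 1 - r := sub_pos.2 hr.2
  refine le_of_mul_le_mul_right ?_ h0
  linarith

/-- If `g` is differentiable at `1` and vanishes there, then `|g r|²` and `r ^ N |g (1 / r)|²`
differ by `o((1 - r)²)`. -/
theorem not_sq_le_norm_sq_sub {g : ℝ → ℂ} (hg : DifferentiableAt ℝ g 1) (h1 : g 1 = 0) {d : ℝ}
    (hd : 0 < d) (N : ℕ) (h : ∀ r ∈ Set.Ioo (0 : ℝ) 1,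
      d * (1 - r) ^ 2 ≤ ‖g r‖ ^ 2 - (r ^ N * ‖g r⁻¹‖) ^ 2) : False := by
  have hs : ContinuousAt (dslope g 1) 1 := continuousAt_dslope_same.2 hg
  have hinv : ContinuousAt (fun r : ℝ => r⁻¹) 1 := continuousAt_inv₀ one_ne_zero
  have hs' : ContinuousAt (fun r : ℝ => dslope g 1 r⁻¹) 1 := by
    refine ContinuousAt.comp (g := dslope g 1) ?_ hinv
    rwa [inv_one]
  have hlim : Filter.Tendsto
      (fun r : ℝ => ‖dslope g 1 r‖ ^ 2 - (r ^ N * (r⁻¹ * ‖dslope g 1 r⁻¹‖)) ^ 2)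
      (nhdsWithin 1 (Set.Iio 1)) (nhds (‖dslope g 1 1‖ ^ 2 -
        (1 ^ N * (1⁻¹ * ‖dslope g 1 1⁻¹‖)) ^ 2)) :=
    (((hs.norm.pow 2).sub (((continuousAt_id.pow N).mul
      (hinv.mul hs'.norm)).pow 2)).tendsto).mono_left nhdsWithin_le_nhds
  -- Both terms tend to |g'(1)|², so the difference divided by (1 - r)² tends to 0.
  simp only [inv_one, one_pow, one_mul, sub_self] at hlim
  refine absurd (ge_of_tendsto hlim (b := d) ?_) hd.not_ge
  filter_upwards [Ioo_mem_nhdsLT (zero_lt_one' ℝ)] with r hr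
  have hgr : ∀ s, ‖g s‖ = |s - 1| * ‖dslope g 1 s‖ := by
    intro s
    rw [← Real.norm_eq_abs, ← norm_smul, sub_smul_dslope, h1, sub_zero]
  have h0 : 0 < 1 - r := sub_pos.2 hr.2
  have hr1 : |r⁻¹ - 1| = r⁻¹ * (1 - r) := by
    have : r⁻¹ - 1 = r⁻¹ * (1 - r) := by
      have := hr.1.ne'
      field_simp
    rw [this, abs_of_pos (mul_pos (inv_pos.2 hr.1) h0)]
  have := h r hr
  rw [hgr, hgr, hr1, abs_sub_comm, abs_of_pos h0] at this
  refine le_of_mul_le_mul_right ?_ (pow_pos h0 2)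
  linarith

/-- Reflecting rz in the unit circle gives z/r, so q̃ on a radius is governed by `q` on its
continuation outside the bidisk. -/
theorem norm_eval_reflection_of_norm_eq_one {n m : ℕ} {q : MvPolynomial (Fin 2) ℂ}
    (hz : q.degreeOf 0 ≤ n) (hw : q.degreeOf 1 ≤ m) {z w : ℂ} (hz1 : ‖z‖ = 1) (hw1 : ‖w‖ = 1)
    {r : ℝ} (hr : 0 < r) :
    ‖eval ![(r : ℂ) * z, (r : ℂ) * w] (reflection n m q)‖ =
      r ^ (n + m) * ‖eval ![((r⁻¹ : ℝ) : ℂ) * z, ((r⁻¹ : ℝ) : ℂ) * w] q‖ := by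
  have hr0 : (r : ℂ) ≠ 0 := Complex.ofReal_ne_zero.2 hr.ne'
  have h : ∀ u : ℂ, ‖u‖ = 1 → 1 / starRingEnd ℂ ((r : ℂ) * u) = ((r⁻¹ : ℝ) : ℂ) * u := by
    intro u hu
    have : (starRingEnd ℂ u)⁻¹ = u := by
      rw [Complex.inv_def, Complex.normSq_eq_norm_sq, Complex.norm_conj, hu]
      simp
    rw [map_mul, Complex.conj_ofReal, one_div, mul_inv, this, Complex.ofReal_inv]
  have hu0 : ∀ u : ℂ, ‖u‖ = 1 → u ≠ 0 := fun u hu => norm_ne_zero_iff.1 (by simp [hu])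
  rw [eval_reflection n m q hz hw _ _ (mul_ne_zero hr0 (hu0 z hz1)) (mul_ne_zero hr0 (hu0 w hw1)),
    h z hz1, h w hw1]
  simp only [norm_mul, norm_pow, hz1, hw1, Complex.norm_conj, Complex.norm_real,
    Real.norm_of_nonneg hr.le, mul_one]
  rw [pow_add]

theorem isStable_of_bidiskBound {n m : ℕ} {q : MvPolynomial (Fin 2) ℂ}
    (hz : q.degreeOf 0 ≤ n) (hw : q.degreeOf 1 ≤ m) {c : ℝ} (hc : 0 < c)
    (hb : BidiskBound n m q c) : IsStable q := by
  intro z w hz1 hw1 h0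
  have hmul : ∀ {r : ℝ} {u : ℂ}, r ∈ Set.Ioo (0 : ℝ) 1 → ‖(r : ℂ) * u‖ = r * ‖u‖ := by
    intro r u hr
    rw [norm_mul, Complex.norm_real, Real.norm_of_nonneg hr.1.le]
  have hle : ∀ {r : ℝ} {u : ℂ}, r ∈ Set.Ioo (0 : ℝ) 1 → ‖u‖ ≤ 1 → ‖(r : ℂ) * u‖ ≤ 1 := by
    intro r u hr hu
    rw [hmul hr]
    nlinarith [hr.1, hr.2, norm_nonneg u]
  have hd : ∀ u : ℂ, DifferentiableAt ℝ (fun r : ℝ => (r : ℂ) * u) 1 := fun u =>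
    (Complex.ofRealCLM.differentiableAt).mul_const u
  have hpos : ∀ {u : ℂ}, ‖u‖ < 1 → 0 < 1 - ‖u‖ ^ 2 := by
    intro u hu
    nlinarith [norm_nonneg u]
  rcases hz1.lt_or_eq with hzl | hze <;> rcases hw1.lt_or_eq with hwl | hwe
  · have h := hb z w hz1 hw1
    rw [h0, norm_zero] at h
    have := mul_pos (mul_pos hc (hpos hzl)) (hpos hwl)
    nlinarith [sq_nonneg ‖eval ![z, w] (reflection n m q)‖]
  · refine not_linear_le_norm_sq (g := fun r : ℝ => eval ![z, (r : ℂ) * w] q)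
      (differentiableAt_eval_line q (differentiableAt_const z) (hd w)) (by simpa using h0)
      (mul_pos hc (hpos hzl)) fun r hr => ?_
    have h := hb z (r * w) hz1 (hle hr hw1)
    rw [hmul hr, hwe, mul_one] at h
    have h2 : 1 - r ≤ 1 - r ^ 2 := by nlinarith [hr.1, hr.2]
    have := mul_le_mul_of_nonneg_left h2 (mul_pos hc (hpos hzl)).le
    linarith [sq_nonneg ‖eval ![z, (r : ℂ) * w] (reflection n m q)‖]
  · refine not_linear_le_norm_sq (g := fun r : ℝ => eval ![(r : ℂ) * z, w] q)
      (differentiableAt_eval_line q (hd z) (differentiableAt_const w)) (by simpa using h0)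
      (mul_pos hc (hpos hwl)) fun r hr => ?_
    have h := hb (r * z) w (hle hr hz1) hw1
    rw [hmul hr, hze, mul_one] at h
    have h2 : 1 - r ≤ 1 - r ^ 2 := by nlinarith [hr.1, hr.2]
    have := mul_le_mul_of_nonneg_left h2 (mul_pos hc (hpos hwl)).le
    linarith [sq_nonneg ‖eval ![(r : ℂ) * z, w] (reflection n m q)‖]
  -- Moving both coordinates at once makes |q̃| equal to r^(n+m) |g(1/r)|.
  · refine not_sq_le_norm_sq_sub (g := fun r : ℝ => eval ![(r : ℂ) * z, (r : ℂ) * w] q)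
      (differentiableAt_eval_line q (hd z) (hd w)) (by simpa using h0) hc (n + m) fun r hr => ?_
    have h := hb (r * z) (r * w) (hle hr hz1) (hle hr hw1)
    rw [hmul hr, hmul hr, hze, hwe, mul_one,
      norm_eval_reflection_of_norm_eq_one hz hw hze hwe hr.1] at h
    refine le_trans ?_ h
    have h2 : 1 - r ≤ 1 - r ^ 2 := by nlinarith [hr.1, hr.2]
    have h3 : (1 - r) ^ 2 ≤ (1 - r ^ 2) ^ 2 := pow_le_pow_left₀ (sub_nonneg.2 hr.2.le) h2 2
    have := mul_le_mul_of_nonneg_left h3 hc.le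
    linarith

theorem theorem1p1 (n m : ℕ) (hn : 0 < n) (hm : 0 < m) (q : MvPolynomial (Fin 2) ℂ)
    (hz : q.degreeOf 0 ≤ n) (hw : q.degreeOf 1 ≤ m) :
    (IsStable q ↔ ∃ c : ℝ, 0 < c ∧ BidiskBound n m q c) ∧
      (IsStable q → ∃ c : ℝ, 0 < c ∧ 1 / (c : ℂ) = torusMeanInv q ∧ BidiskBound n m q c) := by
  have key : IsStable q →
      ∃ c : ℝ, 0 < c ∧ 1 / (c : ℂ) = torusMeanInv q ∧ BidiskBound n m q c := by
    intro hq
    obtain ⟨c, hc, hcq⟩ := exists_pos_one_div_eq_torusMeanInv hq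
    exact ⟨c, hc, hcq, bidiskBound_of_isStable hn hz hw hq hc hcq⟩
  refine ⟨⟨fun hq => ?_, fun ⟨c, hc, hb⟩ => isStable_of_bidiskBound hz hw hc hb⟩, key⟩
  obtain ⟨c, hc, -, hb⟩ := key hq
  exact ⟨c, hc, hb⟩
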